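/- Let $M$ be a smooth compact connected manifold (without boundary), let $m$ be a smooth volume measure on $M$, normalized to be a probability measure (that is, a Borel probability measure which in every smooth chart has a positive $C^\infty$ density with respect to Lebesgue measure), and fix an integer $r \ge 0$. Let $\mathrm{Diff}^r_m(M)$ be the space of $C^r$ diffeomorphisms of $M$ that preserve $m$, with the $C^r$ topology; for $r=0$ these are the homeomorphisms of $M$ that preserve $m$, with the topology in which $f_n \to f$ if and only if $f_n \to f$ and $f_n^{-1} \to f^{-1}$ uniformly. For a compact metrizable space $X$ let $\mathcal{M}(X)$ be the (compact metrizable) space of Borel probability measures on $X$ with the weak-star topology. For $f \in \mathrm{Diff}^r_m(M)$ let $\kappa_f \in \mathcal{M}(\mathcal{M}(M))$ be the ergodic decomposition of $m$ with respect to $f$, that is, the unique element of $\mathcal{M}(\mathcal{M}(M))$ such that $m = \int \nu \, d\kappa_f(\nu)$ and such that $\kappa_f$-almost every $\nu$ is $f$-invariant and ergodic. Then the points of continuity of the map $$f \in \mathrm{Diff}^r_m(M) \mapsto \kappa_f \in \mathcal{M}(\mathcal{M}(M))$$ form a residual subset of $\mathrm{Diff}^r_m(M)$, that is, a subset that contains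 a countable intersection of dense open subsets. -/

import Mathlib

open MeasureTheory Topology
open scoped Manifold ContDiff

/-! ### Borel structure on spaces of probability measures -/

/-- For a compact metrizable space `X`, the `σ`-algebra that Mathlib puts on `ProbabilityMeasure X`
(generated by the evaluations `μ ↦ μ s`) is the Borel `σ`-algebra of the weak-star topology.  So
`ProbabilityMeasure (ProbabilityMeasure X)` is the space of all Borel probability measures on the
space of Borel probability measures on `X`, and it carries the weak-star topology. -/
instance instBorelSpaceProbabilityMeasure {X : Type*} [TopologicalSpace X] [CompactSpace X]
    [T2Space X] [SecondCountableTopology X] [MeasurableSpace X] [BorelSpace X] :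
    BorelSpace (ProbabilityMeasure X) := by
  refine ⟨le_antisymm ?_ ?_⟩
  · -- every evaluation is Borel measurable
    let _ : MeasurableSpace (ProbabilityMeasure X) := borel _
    have _ : BorelSpace (ProbabilityMeasure X) := ⟨rfl⟩
    have key : Measurable (fun μ : ProbabilityMeasure X => (μ : Measure X)) := by
      refine Measurable.measure_of_isPiSystem_of_isProbabilityMeasure
        (S := {s : Set X | IsClosed s}) ?_ isPiSystem_isClosed ?_
      · rw [‹BorelSpace X›.measurable_eq, borel_eq_generateFrom_isClosed]
      · intro s hs
        refine measurable_of_tendsto_metrizable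
          (f := fun n (μ : ProbabilityMeasure X) => ∫⁻ x, hs.apprSeq n x ∂(μ : Measure X)) ?_ ?_
        · intro n
          exact (ProbabilityMeasure.continuous_lintegral_boundedContinuousFunction
            (hs.apprSeq n)).measurable
        · rw [tendsto_pi_nhds]
          intro μ
          exact HasOuterApproxClosed.tendsto_lintegral_apprSeq hs (μ : Measure X)
    exact key.comap_le
  · -- weak-star open sets are measurable: countably many integrals determine the topology
    let φ : ℕ → C(X, ℝ) := TopologicalSpace.denseSeq C(X, ℝ)
    let F : ProbabilityMeasure X → (ℕ → ℝ) := fun μ j => ∫ x, φ j x ∂(μ : Measure X)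
    have hcont : Continuous F := continuous_pi fun j =>
      ProbabilityMeasure.continuous_integral_continuousMap (φ j)
    have hinj : Function.Injective F := by
      intro μ ν h
      have hc : ∀ f : C(X, ℝ), ∫ x, f x ∂(μ : Measure X) = ∫ x, f x ∂(ν : Measure X) := by
        intro f
        have hint : ∀ ρ : ProbabilityMeasure X,
            Continuous fun g : C(X, ℝ) => ∫ x, g x ∂(ρ : Measure X) := fun ρ =>
          (LipschitzWith.of_dist_le_mul (K := 1) fun g g' => by
            have hi : ∀ k : C(X, ℝ), Integrable k (ρ : Measure X) := fun k =>
              (BoundedContinuousFunction.mkOfCompact k).integrable (ρ : Measure X)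
            rw [dist_eq_norm, ← integral_sub (hi g) (hi g')]
            refine (norm_integral_le_of_norm_le_const (C := dist g g')
              (ae_of_all _ fun x => ?_)).trans (by simp)
            rw [← dist_eq_norm]
            exact ContinuousMap.dist_apply_le_dist x).continuous
        exact congrFun ((TopologicalSpace.denseRange_denseSeq C(X, ℝ)).equalizer
          (hint μ) (hint ν) (funext fun j => congrFun h j)) f
      apply Subtype.ext
      have _ : IsFiniteMeasure (μ.1) := inferInstanceAs (IsFiniteMeasure (μ : Measure X))
      have _ : IsFiniteMeasure (ν.1) := inferInstanceAs (IsFiniteMeasure (ν : Measure X))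
      exact ext_of_forall_integral_eq_of_IsFiniteMeasure
        (fun f => hc f.toContinuousMap)
    have hemb : IsInducing F := (hcont.isClosedEmbedding hinj).isInducing
    have hmeas : Measurable F := by
      refine measurable_pi_lambda _ fun j => ?_
      have h2 : Measurable fun μ : ProbabilityMeasure X => (μ : Measure X) := measurable_subtype_coe
      have hi : ∀ ρ : ProbabilityMeasure X, Integrable (φ j) (ρ : Measure X) := fun ρ =>
        (BoundedContinuousFunction.mkOfCompact (φ j)).integrable (ρ : Measure X)
      have h3 : ∀ g : C(X, ℝ), Measurable fun μ : ProbabilityMeasure X =>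
          (∫⁻ x, ENNReal.ofReal (g x) ∂(μ : Measure X)).toReal := fun g =>
        ((Measure.measurable_lintegral g.continuous.measurable.ennreal_ofReal).comp h2).ennreal_toReal
      have h4 := (h3 (φ j)).sub (h3 (-φ j))
      convert h4 using 1
      funext μ
      exact integral_eq_lintegral_pos_part_sub_lintegral_neg_part (hi μ)
    rw [hemb.eq_induced, borel_comap, ← BorelSpace.measurable_eq (α := ℕ → ℝ)]
    exact hmeas.comap_le

/-! ### Ergodic decompositions -/

/-- `l` is a decomposition of the measure `μ`: `μ = ∫ ν dl(ν)`, that is, `μ` is the average with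
respect to `l` of the probability measures `ν`. -/
def IsDecomposition {X : Type*} [MeasurableSpace X] (μ : Measure X)
    (l : Measure (ProbabilityMeasure X)) : Prop :=
  ∀ s : Set X, MeasurableSet s → μ s = ∫⁻ ν : ProbabilityMeasure X, (ν : Measure X) s ∂l

/-- `l` is an ergodic decomposition of `μ` with respect to `f`: it is a decomposition of `μ`
that gives full weight to the set of `f`-invariant ergodic probability measures. -/
def IsErgodicDecomposition {X : Type*} [MeasurableSpace X] (f : X → X) (μ : Measure X)
    (l : Measure (ProbabilityMeasure X)) : Prop :=
  IsDecomposition μ l ∧ ∀ᵐ ν : ProbabilityMeasure X ∂l, Ergodic f (ν : Measure X)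

/-! ### Smooth volume measures and volume-preserving diffeomorphisms -/

section Manifold

variable (d : ℕ) {M : Type*} [TopologicalSpace M] [ChartedSpace (EuclideanSpace ℝ (Fin d)) M]

/-- `m` is a smooth volume measure on the `d`-manifold `M`: in every smooth chart it has a
`C^∞` positive density with respect to Lebesgue measure. -/
def IsSmoothVolume [MeasurableSpace M] (m : Measure M) : Prop :=
  ∀ φ ∈ IsManifold.maximalAtlas (𝓡 d) ∞ M,
    ∃ ρ : EuclideanSpace ℝ (Fin d) → ℝ, ContDiffOn ℝ ∞ ρ φ.target ∧ (∀ y ∈ φ.target, 0 < ρ y) ∧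
      ∀ s : Set (EuclideanSpace ℝ (Fin d)), MeasurableSet s →
        m (φ.source ∩ φ ⁻¹' s) = ∫⁻ y in φ.target ∩ s, ENNReal.ofReal (ρ y)

/-- The basic `C^r` neighbourhood of `f` given by two smooth charts `φ`, `ψ`, a set `K` in the
domain of `φ` and `ε`: the maps `g` that send `K` into the domain of `ψ` and whose expression in
the two charts is `ε`-close on `K` to the expression of `f`, with all derivatives up to order `r`.
(It is used for compact `K` with `f K` in the domain of `ψ`.) -/
def chartNhd (r : ℕ) (f : M → M) (φ ψ : OpenPartialHomeomorph M (EuclideanSpace ℝ (Fin d)))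
    (K : Set M) (ε : ℝ) : Set (M → M) :=
  {g | Set.MapsTo g K ψ.source ∧ ∀ k ≤ r, ∀ x ∈ K,
    ‖iteratedFDeriv ℝ k (fun y => ψ (g (φ.symm y))) (φ x) -
      iteratedFDeriv ℝ k (fun y => ψ (f (φ.symm y))) (φ x)‖ < ε}

/-- The set `Diff^r_m(M)` of `C^r` diffeomorphisms of `M` (homeomorphisms, if `r = 0`) that leave
the measure `m` invariant. -/
def VolDiffeo [MeasurableSpace M] (r : ℕ) (m : Measure M) : Type _ :=
  {f : Diffeomorph (𝓡 d) (𝓡 d) M M (r : WithTop ℕ∞) // MeasurePreserving f m m}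

namespace VolDiffeo

variable {d} [MeasurableSpace M] {r : ℕ} {m : Measure M}

/-- The underlying map, as a continuous map. -/
noncomputable def toMap (f : VolDiffeo d r m) : C(M, M) := ⟨f.1, f.1.continuous⟩

/-- The underlying map of the inverse, as a continuous map. -/
noncomputable def invMap (f : VolDiffeo d r m) : C(M, M) := ⟨f.1.symm, f.1.symm.continuous⟩

/-- The `C^r` topology on `Diff^r_m(M)`, for compact `M`: uniform (that is, compact-open)
convergence of `f` and of `f⁻¹`, and uniform convergence on compact sets, in charts, of the
derivatives of `f` up to order `r`.  For `r = 0` this is uniform convergence of `f` and `f⁻¹`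
(the chart conditions are then redundant); for `r ≥ 1` it is the usual `C^r` topology (inversion
is continuous for the uniform topology on homeomorphisms of a compact space, so the condition on
`f⁻¹` is then redundant). -/
noncomputable instance : TopologicalSpace (VolDiffeo d r m) :=
  TopologicalSpace.induced (fun f => (toMap f, invMap f)) inferInstance ⊓
    TopologicalSpace.generateFrom
      {S | ∃ (f : VolDiffeo d r m) (φ ψ : OpenPartialHomeomorph M (EuclideanSpace ℝ (Fin d)))
          (K : Set M) (ε : ℝ),
        φ ∈ IsManifold.maximalAtlas (𝓡 d) ∞ M ∧ ψ ∈ IsManifold.maximalAtlas (𝓡 d) ∞ M ∧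
        IsCompact K ∧ K ⊆ φ.source ∧ Set.MapsTo (toMap f) K ψ.source ∧ 0 < ε ∧
        S = {g | ⇑(toMap g) ∈ chartNhd d r (toMap f) φ ψ K ε}}

end VolDiffeo

end Manifold

/-! For a continuous function $\varphi$ let $H_\varphi(f)=\int(\int\varphi\,d\nu)^2\,d\kappa_f(\nu)$
(`meanSqIntegral`), and let $B_N(f)$ be the squared $L^2(m)$ norm of the Birkhoff average of
$\varphi$ of length $N+1$ (`sqNormBirkhoff`). On an ergodic component $\nu$ the average has mean
$\int\varphi\,d\nu$, so $B_N(f)-H_\varphi(f)$ is the $\kappa_f$-mean of its variances. Hence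
$H_\varphi\le B_N$, and $B_N\to H_\varphi$ by the mean ergodic theorem. Each $B_N$ is continuous in
$f$, so $H_\varphi=\inf_N B_N$ is upper semicontinuous and is continuous at the points of a residual
set. Letting $\varphi$ run over a dense sequence costs only a countable intersection.

The same variances control how far $\kappa_f$ is from the distribution under $m$ of the empirical
measure of an orbit segment of length $N+1$
(`IsErgodicDecomposition.abs_integral_sub_integral_orbitMeasure_le`). For fixed $N$ that
distribution depends continuously on $f$. At a common continuity point of the $H_\varphi$ the error,
once small, stays small nearby, so $\kappa$ is continuous there. Letting $N\to\infty$ with $f$ fixed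
gives uniqueness of $\kappa_f$; existence comes from conditioning $m$ on the invariant sets. -/

open Filter

/-! ### Mean ergodic theorem and the invariant σ-algebra -/

/-- **Mean ergodic theorem** in terms of functions: the Birkhoff averages of a square integrable
function converge in the mean to an invariant function. -/
theorem exists_invariant_tendsto_lintegral_birkhoffAverage_sub {Ω : Type*} [MeasurableSpace Ω]
    {μ : Measure Ω} [IsProbabilityMeasure μ] {T : Ω → Ω} (hT : MeasurePreserving T μ μ)
    {φ : Ω → ℝ} (hφ : MemLp φ 2 μ) :
    ∃ h : Ω → ℝ, StronglyMeasurable h ∧ h ∘ T =ᵐ[μ] h ∧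
      Tendsto (fun N => ∫⁻ x, ‖birkhoffAverage ℝ T φ N x - h x‖ₑ ∂μ) atTop (𝓝 0) := by
  -- The Koopman operator is an isometry, so von Neumann's theorem applies; the limit is the
  -- projection to its fixed space.
  let U : Lp ℝ 2 μ →L[ℝ] Lp ℝ 2 μ :=
    (Lp.compMeasurePreservingₗᵢ ℝ T hT).toContinuousLinearMap
  have hU1 : ∀ g : Lp ℝ 2 μ, U g = Lp.compMeasurePreserving T hT g := fun g => rfl
  let p : Lp ℝ 2 μ := ((U.eqLocus (1 : Lp ℝ 2 μ →L[ℝ] Lp ℝ 2 μ)).orthogonalProjectionOnto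
    (hφ.toLp φ)).1
  have hlim : Tendsto (birkhoffAverage ℝ U id · (hφ.toLp φ)) atTop (𝓝 p) :=
    U.tendsto_birkhoffAverage_orthogonalProjection
      (LinearIsometry.norm_toContinuousLinearMap_le _) _
  have hfix : U p = p :=
    ((U.eqLocus (1 : Lp ℝ 2 μ →L[ℝ] Lp ℝ 2 μ)).orthogonalProjectionOnto (hφ.toLp φ)).2
  have hiter : ∀ k : ℕ, (U^[k] (hφ.toLp φ) : Ω → ℝ) =ᵐ[μ] φ ∘ T^[k] := by
    intro k
    have h1 : U^[k] (hφ.toLp φ) = Lp.compMeasurePreserving T^[k] (hT.iterate k) (hφ.toLp φ) :=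
      congrFun (Lp.compMeasurePreserving_iterate hT k) _
    rw [h1]
    exact (Lp.coeFn_compMeasurePreserving _ _).trans
      ((hT.iterate k).quasiMeasurePreserving.ae_eq_comp hφ.coeFn_toLp)
  have hsum : ∀ N : ℕ, (birkhoffSum U id N (hφ.toLp φ) : Lp ℝ 2 μ) =ᵐ[μ] birkhoffSum T φ N := by
    intro N
    induction N with
    | zero =>
      simp only [birkhoffSum_zero]
      exact Lp.coeFn_zero _ _ _
    | succ N ih =>
      simp only [birkhoffSum_succ]
      refine (Lp.coeFn_add _ _).trans ?_
      filter_upwards [ih, hiter N] with x h1 h2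
      rw [Pi.add_apply, h1, birkhoffSum_succ]
      exact congrArg _ h2
  have havg : ∀ N : ℕ, (birkhoffAverage ℝ U id N (hφ.toLp φ) : Lp ℝ 2 μ) =ᵐ[μ]
      birkhoffAverage ℝ T φ N := by
    intro N
    refine (Lp.coeFn_smul _ _).trans ?_
    filter_upwards [hsum N] with x h1
    simp [birkhoffAverage, h1]
  refine ⟨p, Lp.stronglyMeasurable p, ?_, ?_⟩
  · refine (Lp.coeFn_compMeasurePreserving p hT).symm.trans ?_
    rw [← hU1, hfix]
  · have h0 : Tendsto (fun N => eLpNorm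
        (⇑(birkhoffAverage ℝ U id N (hφ.toLp φ)) - ⇑p) 2 μ) atTop (𝓝 0) :=
      (Lp.tendsto_Lp_iff_tendsto_eLpNorm' _ _).1 hlim
    refine tendsto_of_tendsto_of_tendsto_of_le_of_le tendsto_const_nhds h0 (fun _ => zero_le)
      fun N => ?_
    have h1 : ∫⁻ x, ‖birkhoffAverage ℝ T φ N x - p x‖ₑ ∂μ =
        eLpNorm (⇑(birkhoffAverage ℝ U id N (hφ.toLp φ)) - ⇑p) 1 μ := by
      rw [eLpNorm_one_eq_lintegral_enorm]
      refine lintegral_congr_ae ?_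
      filter_upwards [havg N] with x hx
      simp [hx]
    show ∫⁻ x, ‖birkhoffAverage ℝ T φ N x - p x‖ₑ ∂μ ≤ _
    rw [h1]
    exact eLpNorm_le_eLpNorm_of_exponent_le one_le_two
      ((Lp.aestronglyMeasurable _).sub (Lp.aestronglyMeasurable _))

/-- The `σ`-algebra of the measurable sets that are invariant under `T` up to a null set. -/
@[reducible]
def aeInvariants {Ω : Type*} [mΩ : MeasurableSpace Ω] (μ : Measure Ω) (T : Ω → Ω) :
    MeasurableSpace Ω where
  MeasurableSet' s := MeasurableSet[mΩ] s ∧ T ⁻¹' s =ᵐ[μ] s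
  measurableSet_empty := ⟨MeasurableSet.empty, by simp⟩
  measurableSet_compl s hs := ⟨hs.1.compl, by
    rw [Set.preimage_compl]
    exact hs.2.compl⟩
  measurableSet_iUnion s hs := ⟨MeasurableSet.iUnion fun i => (hs i).1, by
    rw [Set.preimage_iUnion]
    exact Filter.EventuallyEq.countable_iUnion fun i => (hs i).2⟩

theorem aeInvariants_le {Ω : Type*} [mΩ : MeasurableSpace Ω] (μ : Measure Ω) (T : Ω → Ω) :
    aeInvariants μ T ≤ mΩ := fun _ hs => hs.1

/-- Allowing invariance up to null sets makes the $L^2$ limit of Birkhoff averages, which is only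
almost everywhere invariant, measurable for this σ-algebra. -/
theorem measurable_aeInvariants {Ω β : Type*} [MeasurableSpace Ω] [MeasurableSpace β]
    {μ : Measure Ω} {T : Ω → Ω} {h : Ω → β} (hm : Measurable h) (hT : h ∘ T =ᵐ[μ] h) :
    Measurable[aeInvariants μ T] h := by
  intro s hs
  refine ⟨hm hs, ?_⟩
  filter_upwards [hT] with x hx
  change (h (T x) ∈ s) = (h x ∈ s)
  rw [← hx]; rfl

/-- Over an almost invariant set $s$, $\int_s\varphi\circ T=\int_{T^{-1}s}\varphi\circ
T=\int_s\varphi$. This will make the conditional measures invariant. -/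
theorem condExp_comp_aeInvariants {Ω : Type*} [mΩ : MeasurableSpace Ω] {μ : Measure Ω}
    [IsFiniteMeasure μ] {T : Ω → Ω} (hT : MeasurePreserving T μ μ) {φ : Ω → ℝ}
    (hφ : Integrable φ μ) :
    μ[φ ∘ T | aeInvariants μ T] =ᵐ[μ] μ[φ | aeInvariants μ T] := by
  refine (ae_eq_condExp_of_forall_setIntegral_eq (aeInvariants_le μ T)
    (hT.integrable_comp_of_integrable hφ) (fun s _ _ => integrable_condExp.integrableOn)
    (fun s hs _ => ?_) stronglyMeasurable_condExp.aestronglyMeasurable).symm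
  rw [setIntegral_condExp (aeInvariants_le μ T) hφ hs]
  rw [← setIntegral_congr_set (f := φ ∘ T) hs.2]
  have := setIntegral_map (μ := μ) (g := T) (f := φ) hs.1
    (by rw [hT.map_eq]; exact hφ.aestronglyMeasurable) hT.measurable.aemeasurable
  rw [hT.map_eq] at this
  exact this

theorem integral_birkhoffAverage {Ω : Type*} [MeasurableSpace Ω] {μ : Measure Ω} {T : Ω → Ω}
    (hT : MeasurePreserving T μ μ) {φ : Ω → ℝ} (hφ : Integrable φ μ) {N : ℕ} (hN : N ≠ 0) :
    ∫ x, birkhoffAverage ℝ T φ N x ∂μ = ∫ x, φ x ∂μ := by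
  have h1 : ∀ k : ℕ, ∫ x, φ (T^[k] x) ∂μ = ∫ x, φ x ∂μ := fun k => by
    have := integral_map (μ := μ) (φ := T^[k]) (f := φ) (hT.iterate k).measurable.aemeasurable
      (by rw [(hT.iterate k).map_eq]; exact hφ.aestronglyMeasurable)
    rw [(hT.iterate k).map_eq] at this
    exact this.symm
  simp only [birkhoffAverage, birkhoffSum, smul_eq_mul]
  have hi : ∀ k ∈ Finset.range N, Integrable (fun x => φ (T^[k] x)) μ := fun k _ =>
    (hT.iterate k).integrable_comp_of_integrable hφ
  rw [integral_const_mul, integral_finsetSum _ hi]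
  have hN' : (N : ℝ) ≠ 0 := Nat.cast_ne_zero.2 hN
  simp [h1, hN']

/-! ### Birkhoff averages of continuous functions and a criterion for ergodicity -/

section CompactSpace

variable {X : Type*} [TopologicalSpace X] [CompactSpace X]

/-- The Birkhoff average of a continuous function, as a continuous function. -/
noncomputable def continuousBirkhoffAverage (T : C(X, X)) (φ : C(X, ℝ)) (N : ℕ) : C(X, ℝ) where
  toFun := birkhoffAverage ℝ T φ N
  continuous_toFun := by
    have h : Continuous (birkhoffSum T φ N) := continuous_finsetSum _ fun k _ =>
      φ.continuous.comp (T.continuous.iterate k)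
    exact h.const_smul (N : ℝ)⁻¹

theorem ContinuousMap.integrable_of_compactSpace [MeasurableSpace X] [OpensMeasurableSpace X]
    (φ : C(X, ℝ)) (μ : Measure X) [IsFiniteMeasure μ] : Integrable φ μ :=
  (BoundedContinuousFunction.mkOfCompact φ).integrable μ

theorem Continuous.integrable_of_compactSpace [MeasurableSpace X] [OpensMeasurableSpace X]
    {φ : X → ℝ} (hφ : Continuous φ) (μ : Measure X) [IsFiniteMeasure μ] : Integrable φ μ :=
  ContinuousMap.integrable_of_compactSpace ⟨φ, hφ⟩ μ

theorem ContinuousMap.integrable_birkhoffAverage [MeasurableSpace X] [OpensMeasurableSpace X]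
    (T : C(X, X)) (φ : C(X, ℝ)) (N : ℕ) (μ : Measure X) [IsFiniteMeasure μ] :
    Integrable (fun x => birkhoffAverage ℝ T φ N x) μ :=
  (continuousBirkhoffAverage T φ N).integrable_of_compactSpace μ

theorem ContinuousMap.continuous_integral [MeasurableSpace X] [OpensMeasurableSpace X]
    (μ : Measure X) [IsFiniteMeasure μ] : Continuous fun φ : C(X, ℝ) => ∫ x, φ x ∂μ := by
  refine (LipschitzWith.of_dist_le_mul (K := ⟨μ.real Set.univ, measureReal_nonneg⟩)
    fun g g' => ?_).continuous
  rw [dist_eq_norm, ← integral_sub (g.integrable_of_compactSpace μ)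
    (g'.integrable_of_compactSpace μ)]
  refine (norm_integral_le_of_norm_le_const (C := dist g g') (ae_of_all _ fun x => ?_)).trans
    (mul_comm _ _).le
  rw [← dist_eq_norm]
  exact ContinuousMap.dist_apply_le_dist x

variable [T2Space X] [SecondCountableTopology X] [MeasurableSpace X] [BorelSpace X]

/-- Two finite measures agree if they give the same integrals to the functions in a dense set. -/
theorem MeasureTheory.Measure.ext_of_forall_mem_dense_integral_eq {μ ν : Measure X}
    [IsFiniteMeasure μ] [IsFiniteMeasure ν] {S : Set C(X, ℝ)} (hS : Dense S)
    (h : ∀ φ ∈ S, ∫ x, φ x ∂μ = ∫ x, φ x ∂ν) : μ = ν := by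
  refine ext_of_forall_integral_eq_of_IsFiniteMeasure fun f => ?_
  exact congrFun (Continuous.ext_on hS (ContinuousMap.continuous_integral μ)
    (ContinuousMap.continuous_integral ν) fun φ hφ => h φ hφ) f.toContinuousMap

/-- An invariant probability measure is ergodic if the Birkhoff averages of the functions in a
dense set come arbitrarily close, in the mean, to constants. -/
theorem ergodic_of_forall_mem_dense {T : C(X, X)} {ν : Measure X} [IsProbabilityMeasure ν]
    {S : Set C(X, ℝ)} (hS : Dense S) (hinv : ∀ φ ∈ S, ∫ x, φ (T x) ∂ν = ∫ x, φ x ∂ν)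
    (hconst : ∀ φ ∈ S, ∀ ε > 0, ∃ N ≠ 0, ∃ c : ℝ,
      ∫ x, |birkhoffAverage ℝ T φ N x - c| ∂ν < ε) : Ergodic T ν := by
  have hT : MeasurePreserving T ν ν := by
    refine ⟨T.continuous.measurable, ?_⟩
    have : IsProbabilityMeasure (ν.map T) :=
      Measure.isProbabilityMeasure_map T.continuous.measurable.aemeasurable
    refine Measure.ext_of_forall_mem_dense_integral_eq hS fun φ hφ => ?_
    rw [integral_map T.continuous.measurable.aemeasurable φ.continuous.aestronglyMeasurable]
    exact hinv φ hφ
  refine ⟨hT, ⟨fun {A} hA hTA => ?_⟩⟩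
  have hTA' : MeasurePreserving T (ν.restrict A) (ν.restrict A) := by
    have := hT.restrict_preimage hA
    rwa [hTA] at this
  -- Both `ν` and its restriction to the invariant set `A` are invariant, so replacing `φ` by its
  -- Birkhoff average changes neither integral. Since the average is close to `c`,
  -- $\int_A\varphi\approx\nu(A)c\approx\nu(A)\int\varphi$. Evaluating the resulting identity at `A`
  -- gives $\nu(A)=\nu(A)^2$.
  have key : ν.restrict A = (ν A).toNNReal • ν := by
    refine Measure.ext_of_forall_mem_dense_integral_eq hS fun φ hφ => ?_
    rw [integral_smul_nnreal_measure]
    refine eq_of_forall_dist_le fun ε hε => ?_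
    obtain ⟨N, hN, c, hc⟩ := hconst φ hφ (ε / 2) (half_pos hε)
    have hi : Integrable (fun x => birkhoffAverage ℝ T φ N x - c) ν :=
      (ContinuousMap.integrable_birkhoffAverage T φ N ν).sub (integrable_const c)
    have h1 : |∫ x in A, φ x ∂ν - ν.real A * c| ≤ ε / 2 := by
      have e : ∫ x in A, φ x ∂ν - ν.real A * c =
          ∫ x in A, (birkhoffAverage ℝ T φ N x - c) ∂ν := by
        rw [integral_sub (ContinuousMap.integrable_birkhoffAverage T φ N _)
          (integrable_const c), integral_birkhoffAverage hTA'
          (φ.integrable_of_compactSpace _) hN]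
        simp
      rw [e]
      refine (abs_integral_le_integral_abs).trans (le_trans ?_ hc.le)
      exact setIntegral_le_integral hi.abs (ae_of_all _ fun x => abs_nonneg _)
    have h2 : |∫ x, φ x ∂ν - c| ≤ ε / 2 := by
      have e : ∫ x, φ x ∂ν - c = ∫ x, (birkhoffAverage ℝ T φ N x - c) ∂ν := by
        rw [integral_sub (ContinuousMap.integrable_birkhoffAverage T φ N _)
          (integrable_const c), integral_birkhoffAverage hT (φ.integrable_of_compactSpace _) hN]
        simp
      rw [e]
      exact (abs_integral_le_integral_abs).trans hc.le
    have hp0 : 0 ≤ ν.real A := measureReal_nonneg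
    have hp1 : ν.real A ≤ 1 := measureReal_le_one
    have e : (ν A).toNNReal • ∫ x, φ x ∂ν = ν.real A * ∫ x, φ x ∂ν := rfl
    rw [e, Real.dist_eq]
    have h3 : |ν.real A * (∫ x, φ x ∂ν - c)| ≤ ε / 2 := by
      rw [abs_mul, abs_of_nonneg hp0]
      nlinarith [abs_nonneg (∫ x, φ x ∂ν - c)]
    have h4 := abs_sub (∫ x in A, φ x ∂ν - ν.real A * c) (ν.real A * (∫ x, φ x ∂ν - c))
    have h5 : ∫ x in A, φ x ∂ν - ν.real A * c - ν.real A * (∫ x, φ x ∂ν - c) =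
      ∫ x in A, φ x ∂ν - ν.real A * ∫ x, φ x ∂ν := by ring
    rw [h5] at h4
    linarith
  have hAA : ν.real A = ν.real A * ν.real A := by
    have := congrArg (fun ρ : Measure X => ρ.real A) key
    simpa [measureReal_def, Measure.restrict_apply_self] using this
  rw [eventuallyConst_set']
  rcases eq_or_ne (ν.real A) 0 with h | h
  · left
    rw [measureReal_eq_zero_iff] at h
    exact ae_eq_empty.2 h
  · right
    have h1 : ν.real A = 1 := by
      field_simp at hAA
      exact hAA.symm
    rw [ae_eq_univ, prob_compl_eq_zero_iff hA]
    rw [← ofReal_measureReal, h1, ENNReal.ofReal_one]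

end CompactSpace

/-! ### Existence of the ergodic decomposition -/

open ProbabilityTheory in
-- Choosing $x$ by $\mu$, then $y$ by the conditional measure at $x$, gives the law of the diagonal
-- pair $(x,x)$, provided that the first coordinate is seen only through `I`.
theorem lintegral_lintegral_condExpKernel_diag {Ω : Type*} {I : MeasurableSpace Ω}
    [mΩ : MeasurableSpace Ω] [StandardBorelSpace Ω] (μ : Measure Ω) [IsFiniteMeasure μ]
    (hI : I ≤ mΩ) {F : Ω × Ω → ENNReal} (hF : Measurable[I.prod mΩ] F) :
    ∫⁻ x, ∫⁻ y, F (x, y) ∂condExpKernel μ I x ∂μ = ∫⁻ x, F (x, x) ∂μ := by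
  have h1 : Measurable[I] fun x => ∫⁻ y, F (x, y) ∂condExpKernel μ I x :=
    @Measurable.lintegral_kernel_prod_right Ω Ω I mΩ (condExpKernel μ I) _ (fun x y => F (x, y)) hF
  rw [← lintegral_trim hI h1]
  have h2 := @Measure.lintegral_compProd Ω Ω I mΩ (μ.trim hI) (condExpKernel μ I) _ _ F hF
  rw [← h2, compProd_trim_condExpKernel hI]
  refine @lintegral_map Ω (Ω × Ω) mΩ (I.prod mΩ) μ F _ hF ?_
  exact Measurable.prodMk (f := id) (g := id) (measurable_id'' hI) measurable_id

open ProbabilityTheory in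
-- The invariant limit `h` can be frozen at the value `h x` on the conditional measure at `x`. The
-- mean over `x` of the resulting $L^1$ distances is the global $L^1$ distance, which tends to zero.
theorem ae_exists_integral_birkhoffAverage_sub_const_lt {Ω : Type*} [mΩ : MeasurableSpace Ω]
    [StandardBorelSpace Ω] {μ : Measure Ω} [IsProbabilityMeasure μ] {T : Ω → Ω}
    (hT : MeasurePreserving T μ μ) {φ : Ω → ℝ} (hm : Measurable φ) (hφ : MemLp φ 2 μ) :
    ∀ᵐ x ∂μ, ∀ ε > 0, ∃ N ≠ 0, ∃ c : ℝ,
      ∫⁻ y, ‖birkhoffAverage ℝ T φ N y - c‖ₑ ∂condExpKernel μ (aeInvariants μ T) x < ε := by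
  obtain ⟨h, hh, hinv, hlim⟩ := exists_invariant_tendsto_lintegral_birkhoffAverage_sub hT hφ
  have hI := aeInvariants_le μ T
  have hA : ∀ N, Measurable (birkhoffAverage ℝ T φ N) := fun N => by
    have : Measurable (birkhoffSum T φ N) :=
      Finset.measurable_fun_sum _ fun k _ => hm.comp (hT.measurable.iterate k)
    exact this.const_smul (N : ℝ)⁻¹
  have hF : ∀ N, Measurable[(aeInvariants μ T).prod mΩ] fun p : Ω × Ω =>
      ‖birkhoffAverage ℝ T φ N p.2 - h p.1‖ₑ := fun N => by
    have h1 : Measurable[(aeInvariants μ T).prod mΩ] fun p : Ω × Ω =>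
        birkhoffAverage ℝ T φ N p.2 :=
      (hA N).comp (@measurable_snd _ _ (aeInvariants μ T) mΩ)
    have h2 : Measurable[(aeInvariants μ T).prod mΩ] fun p : Ω × Ω => h p.1 :=
      (measurable_aeInvariants hh.measurable hinv).comp
        (@measurable_fst _ _ (aeInvariants μ T) mΩ)
    have h3 : Measurable fun q : ℝ × ℝ => ‖q.1 - q.2‖ₑ := by fun_prop
    exact h3.comp (Measurable.prodMk h1 h2)
  set V : ℕ → Ω → ENNReal := fun N x =>
    ∫⁻ y, ‖birkhoffAverage ℝ T φ N y - h x‖ₑ ∂condExpKernel μ (aeInvariants μ T) x with hV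
  have hVm : ∀ N, Measurable (V N) := fun N =>
    (@Measurable.lintegral_kernel_prod_right Ω Ω (aeInvariants μ T) mΩ
      (condExpKernel μ (aeInvariants μ T)) _
      (fun x y => ‖birkhoffAverage ℝ T φ N y - h x‖ₑ) (hF N)).mono hI le_rfl
  have hVint : ∀ N, ∫⁻ x, V N x ∂μ = ∫⁻ x, ‖birkhoffAverage ℝ T φ N x - h x‖ₑ ∂μ := fun N =>
    lintegral_lintegral_condExpKernel_diag μ hI (hF N)
  -- The infimum over `N` has zero integral, so no almost everywhere convergent subsequence is
  -- needed. The shift excludes the empty average.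
  have hzero : ∫⁻ x, ⨅ N, V (N + 1) x ∂μ = 0 := by
    refine le_antisymm (ge_of_tendsto' (hlim.comp (tendsto_add_atTop_nat 1)) fun N => ?_) zero_le
    rw [Function.comp_apply, ← hVint]
    exact lintegral_mono fun x => iInf_le _ N
  rw [lintegral_eq_zero_iff (Measurable.iInf fun N => hVm (N + 1))] at hzero
  filter_upwards [hzero] with x hx ε hε
  have hx' : ⨅ N, V (N + 1) x < ε := by
    have : ⨅ N, V (N + 1) x = 0 := hx
    rwa [this]
  obtain ⟨N, hN⟩ := iInf_lt_iff.1 hx'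
  exact ⟨N + 1, N.succ_ne_zero, h x, hN⟩

section CompactSpace

variable {X : Type*} [TopologicalSpace X] [CompactSpace X] [T2Space X] [SecondCountableTopology X]
  [MeasurableSpace X] [BorelSpace X]

open ProbabilityTheory in
/-- Every invariant probability measure of a continuous map of a compact metrizable space has an
ergodic decomposition. -/
theorem exists_isErgodicDecomposition {T : C(X, X)} {m : Measure X} [IsProbabilityMeasure m]
    (hT : MeasurePreserving T m m) :
    ∃ l : ProbabilityMeasure (ProbabilityMeasure X),
      IsErgodicDecomposition T m (l : Measure (ProbabilityMeasure X)) := by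
  let _ : MetricSpace X := TopologicalSpace.metrizableSpaceMetric X
  have hI := aeInvariants_le m T
  let K : X → ProbabilityMeasure X := fun x => ⟨condExpKernel m (aeInvariants m T) x, inferInstance⟩
  have hK0 : Measurable[aeInvariants m T] fun x => condExpKernel m (aeInvariants m T) x :=
    Kernel.measurable _
  have hK : Measurable K := Measurable.subtype_mk (hK0.mono hI le_rfl)
  let l : Measure (ProbabilityMeasure X) := m.map K
  have hl : IsProbabilityMeasure l := Measure.isProbabilityMeasure_map hK.aemeasurable
  refine ⟨⟨l, hl⟩, ?_, ?_⟩
  · intro s hs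
    have h1 : Measurable fun ν : ProbabilityMeasure X => (ν : Measure X) s :=
      (Measure.measurable_coe hs).comp measurable_subtype_coe
    change m s = ∫⁻ ν : ProbabilityMeasure X, (ν : Measure X) s ∂(m.map K)
    rw [lintegral_map h1 hK]
    have h2 := lintegral_lintegral_condExpKernel_diag m hI (F := fun p => s.indicator 1 p.2)
      ((measurable_one.indicator hs).comp (@measurable_snd _ _ (aeInvariants m T) _))
    simp only [lintegral_indicator_one hs] at h2
    exact h2.symm
  · let φ : ℕ → C(X, ℝ) := TopologicalSpace.denseSeq C(X, ℝ)
    -- A Borel form of the ergodicity criterion: countably many test functions and tolerances. Its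
    -- measurability lets the almost sure statement pass through the image measure `l`.
    let G : Set (ProbabilityMeasure X) :=
      (⋂ j, {ν | ∫ x, φ j (T x) ∂(ν : Measure X) = ∫ x, φ j x ∂(ν : Measure X)}) ∩
      ⋂ j, ⋂ n : ℕ, ⋃ N : {N : ℕ // N ≠ 0}, ⋃ c : ℝ,
        {ν | ∫ x, |birkhoffAverage ℝ T (φ j) N x - c| ∂(ν : Measure X) < 1 / ((n : ℝ) + 1)}
    have hG : MeasurableSet G := by
      refine (MeasurableSet.iInter fun j => ?_).inter
        (MeasurableSet.iInter fun j => MeasurableSet.iInter fun n => ?_)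
      · exact (isClosed_eq (ProbabilityMeasure.continuous_integral_continuousMap ((φ j).comp T))
          (ProbabilityMeasure.continuous_integral_continuousMap (φ j))).measurableSet
      · refine (isOpen_iUnion fun N => isOpen_iUnion fun c => ?_).measurableSet
        exact isOpen_lt (ProbabilityMeasure.continuous_integral_continuousMap
          |continuousBirkhoffAverage T (φ j) N - ContinuousMap.const X c|) continuous_const
    have hGerg : ∀ ν ∈ G, Ergodic T (ν : Measure X) := by
      rintro ν ⟨h1, h2⟩
      simp only [Set.mem_iInter, Set.mem_iUnion, Set.mem_ofPred_eq] at h1 h2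
      refine ergodic_of_forall_mem_dense (TopologicalSpace.denseRange_denseSeq C(X, ℝ)) ?_ ?_
      · rintro _ ⟨j, rfl⟩
        exact h1 j
      · rintro _ ⟨j, rfl⟩ ε hε
        obtain ⟨n, hn⟩ := exists_nat_one_div_lt hε
        obtain ⟨N, c, h⟩ := h2 j n
        exact ⟨N, N.2, c, h.trans hn⟩
    have hKG : ∀ᵐ x ∂m, K x ∈ G := by
      have h1 : ∀ᵐ x ∂m, ∀ j, ∫ y, φ j (T y) ∂condExpKernel m (aeInvariants m T) x =
          ∫ y, φ j y ∂condExpKernel m (aeInvariants m T) x := by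
        refine ae_all_iff.2 fun j => ?_
        have hi := (φ j).integrable_of_compactSpace m
        have hi' := ((φ j).comp T).integrable_of_compactSpace m
        filter_upwards [condExp_comp_aeInvariants hT hi,
          condExp_ae_eq_integral_condExpKernel hI hi,
          condExp_ae_eq_integral_condExpKernel hI hi'] with x e1 e2 e3
        exact e3.symm.trans (e1.trans e2)
      have h2 : ∀ᵐ x ∂m, ∀ j, ∀ ε > 0, ∃ N ≠ 0, ∃ c : ℝ,
          ∫⁻ y, ‖birkhoffAverage ℝ T (φ j) N y - c‖ₑ ∂condExpKernel m (aeInvariants m T) x < ε :=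
        ae_all_iff.2 fun j => ae_exists_integral_birkhoffAverage_sub_const_lt hT
          (φ j).continuous.measurable
          (MemLp.of_bound (φ j).continuous.aestronglyMeasurable ‖φ j‖
            (ae_of_all _ (φ j).norm_coe_le_norm))
      filter_upwards [h1, h2] with x hx1 hx2
      refine ⟨Set.mem_iInter.2 hx1, Set.mem_iInter.2 fun j => Set.mem_iInter.2 fun n => ?_⟩
      have hpos : (0 : ℝ) < 1 / ((n : ℝ) + 1) := by positivity
      obtain ⟨N, hN, c, h⟩ := hx2 j (ENNReal.ofReal (1 / ((n : ℝ) + 1)))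
        (ENNReal.ofReal_pos.2 hpos)
      refine Set.mem_iUnion.2 ⟨⟨N, hN⟩, Set.mem_iUnion.2 ⟨c, ?_⟩⟩
      have hi : Integrable (fun y => birkhoffAverage ℝ T (φ j) N y - c)
          (condExpKernel m (aeInvariants m T) x) :=
        (ContinuousMap.integrable_birkhoffAverage T (φ j) N _).sub (integrable_const c)
      rw [← ofReal_integral_norm_eq_lintegral_enorm hi, ENNReal.ofReal_lt_ofReal_iff hpos] at h
      exact h
    have h3 : ∀ᵐ ν ∂l, ν ∈ G := (ae_map_iff hK.aemeasurable hG).2 hKG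
    exact h3.mono hGerg

end CompactSpace

/-! ### Continuity points of semicontinuous functions -/

/-- The points of continuity of an upper semicontinuous real function form a residual set. -/
theorem UpperSemicontinuous.setOf_continuousAt_mem_residual {V : Type*} [TopologicalSpace V]
    {f : V → ℝ} (hf : UpperSemicontinuous f) : {v | ContinuousAt f v} ∈ residual V := by
  have hopen : ∀ q : ℚ, IsOpen {v | f v < q} := fun q => hf.isOpen_preimage (q : ℝ)
  -- The frontier of an open set is closed with empty interior. Off all these frontiers, $f(v)\ge q$
  -- forces $f\ge q$ near $v$, which is the missing lower semicontinuity.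
  have h : ∀ q : ℚ, (frontier {v | f v < q})ᶜ ∈ residual V := fun q => by
    refine residual_of_dense_open isClosed_frontier.isOpen_compl ?_
    rw [← interior_eq_empty_iff_dense_compl, ← frontier_compl]
    exact interior_frontier (hopen q).isClosed_compl
  filter_upwards [countable_iInter_mem.2 h] with v hv
  refine continuousAt_iff_lower_upperSemicontinuousAt.2 ⟨fun c hc => ?_, hf v⟩
  obtain ⟨q, hcq, hq⟩ := exists_rat_btwn hc
  have hv' : v ∉ closure {v | f v < q} := fun hcl =>
    (Set.mem_iInter.1 hv q) (by
      rw [(hopen q).frontier_eq]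
      exact ⟨hcl, not_lt.2 hq.le⟩)
  filter_upwards [isClosed_closure.isOpen_compl.mem_nhds hv'] with w hw
  exact hcq.trans_le (not_lt.1 fun h => hw (subset_closure h))

/-! ### Second moments of Birkhoff averages, and orbit measures -/

section CompactSpace

variable {X : Type*} [TopologicalSpace X] [CompactSpace X]

theorem continuous_integral_of_continuous_uncurry {V : Type*} [TopologicalSpace V]
    [MeasurableSpace X] [OpensMeasurableSpace X] (μ : Measure X) [IsFiniteMeasure μ]
    {F : V → X → ℝ} (hF : Continuous fun p : V × X => F p.1 p.2) :
    Continuous fun v => ∫ x, F v x ∂μ :=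
  (ContinuousMap.continuous_integral μ).comp (ContinuousMap.curry ⟨_, hF⟩).continuous

theorem norm_birkhoffAverage_le (T : X → X) (φ : C(X, ℝ)) (N : ℕ) (x : X) :
    |birkhoffAverage ℝ T φ N x| ≤ ‖φ‖ := by
  rcases eq_or_ne N 0 with rfl | hN
  · simp
  have hN' : (0 : ℝ) < N := Nat.cast_pos.2 (Nat.pos_of_ne_zero hN)
  have h1 : |birkhoffSum T φ N x| ≤ N * ‖φ‖ := by
    refine (Finset.abs_sum_le_sum_abs _ _).trans ?_
    refine (Finset.sum_le_sum fun k _ => φ.norm_coe_le_norm (T^[k] x)).trans ?_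
    simp
  rw [birkhoffAverage, smul_eq_mul, abs_mul, abs_of_pos (inv_pos.2 hN')]
  rw [inv_mul_le_iff₀ hN']
  exact h1

section Decomposition

variable [MeasurableSpace X] [BorelSpace X]

open ProbabilityTheory in
theorem IsDecomposition.integral_eq {m : Measure X} [IsFiniteMeasure m]
    {l : Measure (ProbabilityMeasure X)} (h : IsDecomposition m l)
    (u : C(X, ℝ)) :
    ∫ x, u x ∂m = ∫ ν : ProbabilityMeasure X, ∫ x, u x ∂(ν : Measure X) ∂l := by
  let η : Kernel (ProbabilityMeasure X) X := ⟨fun ν => (ν : Measure X), measurable_subtype_coe⟩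
  have hm : m = (η ∘ₖ Kernel.const Unit l) () := by
    ext s hs
    rw [Kernel.comp_apply' _ _ _ hs]
    exact h s hs
  have hu : Integrable u ((η ∘ₖ Kernel.const Unit l) ()) := hm ▸ u.integrable_of_compactSpace m
  calc ∫ x, u x ∂m = ∫ x, u x ∂((η ∘ₖ Kernel.const Unit l) ()) := by rw [← hm]
    _ = _ := Kernel.integral_comp hu

/-- The Birkhoff average has mean $\int\varphi\,d\nu$ by invariance, so this is the usual formula
for a variance. -/
theorem integral_sq_integral_sub_birkhoffAverage {T : C(X, X)} {ν : Measure X}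
    [IsProbabilityMeasure ν] (hT : MeasurePreserving T ν ν) (φ : C(X, ℝ)) {N : ℕ} (hN : N ≠ 0) :
    ∫ x, (∫ y, φ y ∂ν - birkhoffAverage ℝ T φ N x) ^ 2 ∂ν =
      ∫ x, birkhoffAverage ℝ T φ N x ^ 2 ∂ν - (∫ y, φ y ∂ν) ^ 2 := by
  set c := ∫ y, φ y ∂ν with hc
  have h1 := ContinuousMap.integrable_birkhoffAverage T φ N ν
  have h2 : Integrable (fun x => birkhoffAverage ℝ T φ N x ^ 2) ν :=
    (continuousBirkhoffAverage T φ N ^ 2).integrable_of_compactSpace ν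
  have e : ∀ x, (c - birkhoffAverage ℝ T φ N x) ^ 2 =
      birkhoffAverage ℝ T φ N x ^ 2 - (2 * c * birkhoffAverage ℝ T φ N x - c ^ 2) := fun x => by ring
  have h3 : Integrable (fun x => 2 * c * birkhoffAverage ℝ T φ N x) ν := h1.const_mul _
  have h4 : Integrable (fun x => 2 * c * birkhoffAverage ℝ T φ N x - c ^ 2) ν :=
    h3.sub (integrable_const _)
  simp only [e]
  rw [integral_sub h2 h4, integral_sub h3 (integrable_const _), integral_const_mul,
    integral_birkhoffAverage hT (φ.integrable_of_compactSpace ν) hN, ← hc]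
  simp
  ring

/-- Ergodicity makes the mean limit a constant `c`, which must be the integral of `φ`. The uniform
bound on the averages turns $L^1$ convergence into convergence of the squares, since
$|a^2-c^2|\le(\|\varphi\|+|c|)\,|a-c|$. -/
theorem Ergodic.tendsto_integral_sq_birkhoffAverage {T : C(X, X)} {ν : Measure X}
    [IsProbabilityMeasure ν] (hT : Ergodic T ν) (φ : C(X, ℝ)) :
    Tendsto (fun N => ∫ x, birkhoffAverage ℝ T φ N x ^ 2 ∂ν) atTop (𝓝 ((∫ y, φ y ∂ν) ^ 2)) := by
  obtain ⟨h, hh, hinv, hlim⟩ := exists_invariant_tendsto_lintegral_birkhoffAverage_sub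
    hT.toMeasurePreserving (MemLp.of_bound (p := 2) φ.continuous.aestronglyMeasurable ‖φ‖
      (ae_of_all _ φ.norm_coe_le_norm))
  obtain ⟨c, hc⟩ := hT.ae_eq_const_of_ae_eq_comp_ae hh.aestronglyMeasurable hinv
  have hA := fun N => ContinuousMap.integrable_birkhoffAverage T φ N ν
  have hi : ∀ N, Integrable (fun x => birkhoffAverage ℝ T φ N x - c) ν := fun N =>
    (hA N).sub (integrable_const c)
  have hL1 : Tendsto (fun N => ∫ x, |birkhoffAverage ℝ T φ N x - c| ∂ν) atTop (𝓝 0) := by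
    rw [← ENNReal.toReal_zero]
    refine ((ENNReal.tendsto_toReal ENNReal.zero_ne_top).comp hlim).congr fun N => ?_
    have e : ∫⁻ x, ‖birkhoffAverage ℝ T φ N x - h x‖ₑ ∂ν =
        ∫⁻ x, ‖birkhoffAverage ℝ T φ N x - c‖ₑ ∂ν :=
      lintegral_congr_ae (hc.mono fun x hx => by simp [hx])
    rw [Function.comp_apply, e, ← ofReal_integral_norm_eq_lintegral_enorm (hi N),
      ENNReal.toReal_ofReal (integral_nonneg fun _ => norm_nonneg _)]
    rfl
  have hcint : ∫ y, φ y ∂ν = c := by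
    have h1 : Tendsto (fun _ : ℕ => |∫ y, φ y ∂ν - c|) atTop (𝓝 0) := by
      refine squeeze_zero' (Eventually.of_forall fun _ => abs_nonneg _) ?_ hL1
      filter_upwards [eventually_ne_atTop 0] with N hN
      have e : ∫ y, φ y ∂ν - c = ∫ x, (birkhoffAverage ℝ T φ N x - c) ∂ν := by
        rw [integral_sub (hA N) (integrable_const c), integral_birkhoffAverage
          hT.toMeasurePreserving (φ.integrable_of_compactSpace ν) hN]
        simp
      rw [e]
      exact abs_integral_le_integral_abs
    have := tendsto_nhds_unique h1 tendsto_const_nhds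
    exact sub_eq_zero.1 (abs_eq_zero.1 this.symm)
  rw [hcint, tendsto_iff_dist_tendsto_zero]
  have hL2 := hL1.const_mul (‖φ‖ + |c|)
  rw [mul_zero] at hL2
  refine squeeze_zero (fun _ => dist_nonneg) (fun N => ?_) hL2
  have h2 : Integrable (fun x => birkhoffAverage ℝ T φ N x ^ 2) ν :=
    (continuousBirkhoffAverage T φ N ^ 2).integrable_of_compactSpace ν
  have e : ∫ x, birkhoffAverage ℝ T φ N x ^ 2 ∂ν - c ^ 2 =
      ∫ x, (birkhoffAverage ℝ T φ N x ^ 2 - c ^ 2) ∂ν := by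
    rw [integral_sub h2 (integrable_const _)]
    simp
  rw [Real.dist_eq, e, ← integral_const_mul]
  refine abs_integral_le_integral_abs.trans (integral_mono
    (h2.sub (integrable_const _)).abs ((hi N).abs.const_mul _) fun x => ?_)
  change |birkhoffAverage ℝ T φ N x ^ 2 - c ^ 2| ≤ (‖φ‖ + |c|) * |birkhoffAverage ℝ T φ N x - c|
  rw [sq_sub_sq, abs_mul]
  exact mul_le_mul_of_nonneg_right ((abs_add_le _ _).trans
    (add_le_add_left (norm_birkhoffAverage_le T φ N x) _)) (abs_nonneg _)

end Decomposition

variable [T2Space X]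

theorem continuous_birkhoffAverage_uncurry (φ : C(X, ℝ)) (N : ℕ) :
    Continuous fun p : C(X, X) × X => birkhoffAverage ℝ p.1 φ N p.2 := by
  have h : ∀ k : ℕ, Continuous fun p : C(X, X) × X => (p.1)^[k] p.2 := by
    intro k
    induction k with
    | zero => exact continuous_snd
    | succ k ih =>
      simp only [Function.iterate_succ_apply']
      exact continuous_fst.eval ih
  have h2 : Continuous fun p : C(X, X) × X => birkhoffSum p.1 φ N p.2 :=
    continuous_finsetSum _ fun k _ => φ.continuous.comp (h k)
  exact h2.const_smul (N : ℝ)⁻¹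

variable [SecondCountableTopology X] [MeasurableSpace X] [BorelSpace X]

/-- The uniform measure on the first `N + 1` points of an orbit. -/
noncomputable def orbitMeasure (N : ℕ) (T : X → X) (x : X) : ProbabilityMeasure X :=
  -- With `N + 1` points the average is never empty, so every index gives a probability measure.
  ⟨((N + 1 : ℕ) : ENNReal)⁻¹ • ∑ k ∈ Finset.range (N + 1), Measure.dirac (T^[k] x), ⟨by
    simp only [Measure.smul_apply, Measure.coe_finsetSum, Finset.sum_apply, measure_univ,
      Finset.sum_const, Finset.card_range, smul_eq_mul, nsmul_eq_mul, mul_one]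
    exact ENNReal.inv_mul_cancel (Nat.cast_ne_zero.2 N.succ_ne_zero) (ENNReal.natCast_ne_top _)⟩⟩

theorem integral_orbitMeasure (N : ℕ) (T : X → X) (x : X) (φ : C(X, ℝ)) :
    ∫ y, φ y ∂(orbitMeasure N T x : Measure X) = birkhoffAverage ℝ T φ (N + 1) x := by
  change ∫ y, φ y ∂(((N + 1 : ℕ) : ENNReal)⁻¹ •
    ∑ k ∈ Finset.range (N + 1), Measure.dirac (T^[k] x)) = _
  rw [integral_smul_measure, integral_finsetSum_measure fun k _ => φ.integrable_of_compactSpace _,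
    ENNReal.toReal_inv, ENNReal.toReal_natCast]
  simp [birkhoffAverage, birkhoffSum]

theorem continuous_orbitMeasure_uncurry (N : ℕ) :
    Continuous fun p : C(X, X) × X => orbitMeasure N p.1 p.2 := by
  rw [ProbabilityMeasure.continuous_iff_forall_continuousMap_continuous_integral]
  intro φ
  simp only [integral_orbitMeasure]
  exact continuous_birkhoffAverage_uncurry φ (N + 1)

end CompactSpace

/-! ### Comparison of decompositions with distributions of orbit measures -/

section CompactSpace

variable {X : Type*} [TopologicalSpace X] [CompactSpace X] [MeasurableSpace X] [BorelSpace X]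

/-- The mean square, with respect to `l`, of the integral of `φ`. -/
noncomputable def meanSqIntegral (l : Measure (ProbabilityMeasure X)) (φ : C(X, ℝ)) : ℝ :=
  ∫ ν : ProbabilityMeasure X, (∫ x, φ x ∂(ν : Measure X)) ^ 2 ∂l

/-- The squared `L²` norm of the Birkhoff average of length `N + 1`. -/
noncomputable def sqNormBirkhoff (m : Measure X) (T : C(X, X)) (φ : C(X, ℝ)) (N : ℕ) : ℝ :=
  ∫ x, birkhoffAverage ℝ T φ (N + 1) x ^ 2 ∂m

theorem continuous_sq_integral (φ : C(X, ℝ)) :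
    Continuous fun ν : ProbabilityMeasure X => (∫ x, φ x ∂(ν : Measure X)) ^ 2 :=
  (ProbabilityMeasure.continuous_integral_continuousMap φ).pow 2

theorem continuous_sqNormBirkhoff_probabilityMeasure (T : C(X, X)) (φ : C(X, ℝ)) (N : ℕ) :
    Continuous fun ν : ProbabilityMeasure X => sqNormBirkhoff (ν : Measure X) T φ N := by
  unfold sqNormBirkhoff
  exact ProbabilityMeasure.continuous_integral_continuousMap
    (continuousBirkhoffAverage T φ (N + 1) ^ 2)

theorem continuous_sqNormBirkhoff_map [T2Space X] (m : Measure X) [IsFiniteMeasure m]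
    (φ : C(X, ℝ)) (N : ℕ) :
    Continuous fun T : C(X, X) => sqNormBirkhoff m T φ N :=
  continuous_integral_of_continuous_uncurry m
    ((continuous_birkhoffAverage_uncurry φ (N + 1)).pow 2)

theorem IsDecomposition.sqNormBirkhoff_eq {m : Measure X} [IsFiniteMeasure m]
    {l : Measure (ProbabilityMeasure X)} (h : IsDecomposition m l) (T : C(X, X)) (φ : C(X, ℝ)) (N : ℕ) :
    sqNormBirkhoff m T φ N =
      ∫ ν : ProbabilityMeasure X, sqNormBirkhoff (ν : Measure X) T φ N ∂l := by
  unfold sqNormBirkhoff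
  exact h.integral_eq (continuousBirkhoffAverage T φ (N + 1) ^ 2)

theorem sq_integral_le_sqNormBirkhoff {T : C(X, X)} {ν : Measure X} [IsProbabilityMeasure ν]
    (hT : MeasurePreserving T ν ν) (φ : C(X, ℝ)) (N : ℕ) :
    (∫ x, φ x ∂ν) ^ 2 ≤ sqNormBirkhoff ν T φ N :=
  sub_nonneg.1 <| (integral_sq_integral_sub_birkhoffAverage hT φ N.succ_ne_zero).symm ▸
    integral_nonneg fun _ => sq_nonneg _

variable [T2Space X] [SecondCountableTopology X]

/-- A continuous function on the space of probability measures has a modulus of continuity in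
terms of finitely many functions from a dense sequence. -/
theorem exists_abs_sub_le_add_mul_sum_sq {φ : ℕ → C(X, ℝ)} (hφ : DenseRange φ)
    (Ψ : C(ProbabilityMeasure X, ℝ)) {ε : ℝ} (hε : 0 < ε) :
    ∃ (J : Finset ℕ) (C : ℝ), 0 ≤ C ∧ ∀ ν ν' : ProbabilityMeasure X, |Ψ ν - Ψ ν'| ≤
      ε + C * ∑ j ∈ J, (∫ x, φ j x ∂(ν : Measure X) - ∫ x, φ j x ∂(ν' : Measure X)) ^ 2 := by
  let Φ : ℕ → ProbabilityMeasure X × ProbabilityMeasure X → ℝ := fun j p =>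
    ∫ x, φ j x ∂(p.1 : Measure X) - ∫ x, φ j x ∂(p.2 : Measure X)
  have hΦ : ∀ j, Continuous (Φ j) := fun j =>
    ((ProbabilityMeasure.continuous_integral_continuousMap (φ j)).comp continuous_fst).sub
      ((ProbabilityMeasure.continuous_integral_continuousMap (φ j)).comp continuous_snd)
  let Z : Set (ProbabilityMeasure X × ProbabilityMeasure X) := {p | ε ≤ |Ψ p.1 - Ψ p.2|}
  have hZ : IsCompact Z := by
    refine IsClosed.isCompact (isClosed_le continuous_const ?_)
    exact ((Ψ.continuous.comp continuous_fst).sub (Ψ.continuous.comp continuous_snd)).abs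
  -- A pair not separated by any `φ j` lies on the diagonal, which misses `Z`; by compactness
  -- finitely many `j` suffice.
  obtain ⟨J, hJ⟩ := hZ.elim_finite_subcover (fun j => {p | Φ j p ≠ 0})
    (fun j => isOpen_ne_fun (hΦ j) continuous_const) (fun p hp => by
      by_contra hcon
      have hne : ∀ j, Φ j p = 0 := by simpa using hcon
      have heq : (p.1 : Measure X) = p.2 := by
        refine Measure.ext_of_forall_mem_dense_integral_eq hφ ?_
        rintro _ ⟨j, rfl⟩
        exact sub_eq_zero.1 (hne j)
      have heq' : p.1 = p.2 := Subtype.ext heq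
      have : ε ≤ |Ψ p.1 - Ψ p.2| := hp
      rw [heq', sub_self, abs_zero] at this
      exact this.not_gt hε)
  have hpos : ∀ p ∈ Z, 0 < ∑ j ∈ J, Φ j p ^ 2 := fun p hp => by
    obtain ⟨j, hjJ, hj⟩ := Set.mem_iUnion₂.1 (hJ hp)
    exact Finset.sum_pos' (fun _ _ => sq_nonneg _) ⟨j, hjJ, sq_pos_of_ne_zero hj⟩
  obtain ⟨c, hc, hcZ⟩ := hZ.exists_forall_le'
    (continuous_finsetSum _ fun j _ => (hΦ j).pow 2).continuousOn hpos
  -- On `Z` the sum of squares is at least `c`, so this constant absorbs the trivial bound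
  -- $2\|\Psi\|$; off `Z` the term `ε` suffices. Squares are used because they integrate to
  -- variances.
  refine ⟨J, 2 * ‖Ψ‖ / c, by positivity, fun ν ν' => ?_⟩
  have hsum : 0 ≤ ∑ j ∈ J, Φ j (ν, ν') ^ 2 := Finset.sum_nonneg fun _ _ => sq_nonneg _
  change |Ψ ν - Ψ ν'| ≤ ε + 2 * ‖Ψ‖ / c * ∑ j ∈ J, Φ j (ν, ν') ^ 2
  by_cases hp : (ν, ν') ∈ Z
  · have h1 : |Ψ ν - Ψ ν'| ≤ 2 * ‖Ψ‖ := by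
      have h2 : |Ψ ν| ≤ ‖Ψ‖ := Ψ.norm_coe_le_norm ν
      have h3 : |Ψ ν'| ≤ ‖Ψ‖ := Ψ.norm_coe_le_norm ν'
      linarith [abs_sub (Ψ ν) (Ψ ν')]
    have h4 : 2 * ‖Ψ‖ = 2 * ‖Ψ‖ / c * c := by field_simp
    have h5 : 2 * ‖Ψ‖ / c * c ≤ 2 * ‖Ψ‖ / c * ∑ j ∈ J, Φ j (ν, ν') ^ 2 :=
      mul_le_mul_of_nonneg_left (hcZ _ hp) (by positivity)
    linarith
  · have h1 : |Ψ ν - Ψ ν'| < ε := not_le.1 hp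
    have h2 : 0 ≤ 2 * ‖Ψ‖ / c * ∑ j ∈ J, Φ j (ν, ν') ^ 2 := by positivity
    linarith

variable {m : Measure X} [IsProbabilityMeasure m] {T : C(X, X)}
  {l : Measure (ProbabilityMeasure X)} [IsProbabilityMeasure l]

theorem IsErgodicDecomposition.meanSqIntegral_le (h : IsErgodicDecomposition T m l)
    (φ : C(X, ℝ)) (N : ℕ) : meanSqIntegral l φ ≤ sqNormBirkhoff m T φ N := by
  rw [h.1.sqNormBirkhoff_eq]
  refine integral_mono_ae ((continuous_sq_integral φ).integrable_of_compactSpace l)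
    ((continuous_sqNormBirkhoff_probabilityMeasure T φ N).integrable_of_compactSpace l) ?_
  filter_upwards [h.2] with ν hν
  exact sq_integral_le_sqNormBirkhoff hν.toMeasurePreserving φ N

/-- Convergence holds on each ergodic component, and all the second moments are bounded by
$\|\varphi\|^2$, so dominated convergence applies. -/
theorem IsErgodicDecomposition.tendsto_sqNormBirkhoff (h : IsErgodicDecomposition T m l)
    (φ : C(X, ℝ)) : Tendsto (sqNormBirkhoff m T φ) atTop (𝓝 (meanSqIntegral l φ)) := by
  have e : sqNormBirkhoff m T φ = fun N =>
      ∫ ν : ProbabilityMeasure X, sqNormBirkhoff (ν : Measure X) T φ N ∂l :=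
    funext fun N => h.1.sqNormBirkhoff_eq T φ N
  rw [e]
  refine tendsto_integral_of_dominated_convergence (fun _ => ‖φ‖ ^ 2)
    (fun N => (continuous_sqNormBirkhoff_probabilityMeasure T φ N).aestronglyMeasurable)
    (integrable_const _) (fun N => ae_of_all _ fun ν => ?_) ?_
  · refine (norm_integral_le_of_norm_le_const (C := ‖φ‖ ^ 2) (ae_of_all _ fun x => ?_)).trans
      (by simp)
    rw [norm_pow]
    exact pow_le_pow_left₀ (norm_nonneg _) (norm_birkhoffAverage_le T φ (N + 1) x) 2
  · filter_upwards [h.2] with ν hν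
    exact (hν.tendsto_integral_sq_birkhoffAverage φ).comp (tendsto_add_atTop_nat 1)

/-- Apply the modulus of continuity to an ergodic component $\nu$ and the orbit measure of a point
$x$, then integrate over $x$ by $\nu$ and over $\nu$ by `l`. The squares become variances, whose
total is the defect on the right. -/
theorem IsErgodicDecomposition.abs_integral_sub_integral_orbitMeasure_le
    (h : IsErgodicDecomposition T m l) {φ : ℕ → C(X, ℝ)} {Ψ : C(ProbabilityMeasure X, ℝ)}
    {ε C : ℝ} {J : Finset ℕ}
    (hΨ : ∀ ν ν' : ProbabilityMeasure X, |Ψ ν - Ψ ν'| ≤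
      ε + C * ∑ j ∈ J, (∫ x, φ j x ∂(ν : Measure X) - ∫ x, φ j x ∂(ν' : Measure X)) ^ 2) (N : ℕ) :
    |∫ ν, Ψ ν ∂l - ∫ x, Ψ (orbitMeasure N T x) ∂m| ≤
      ε + C * ∑ j ∈ J, (sqNormBirkhoff m T (φ j) N - meanSqIntegral l (φ j)) := by
  have hT : Continuous fun x : X => ((T, x) : C(X, X) × X) := by fun_prop
  have hor : Continuous fun x => orbitMeasure N T x := by
    have := (continuous_orbitMeasure_uncurry N).comp hT
    exact this
  let u : C(X, ℝ) := ⟨fun x => Ψ (orbitMeasure N T x), Ψ.continuous.comp hor⟩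
  have hucont := ProbabilityMeasure.continuous_integral_continuousMap u
  have e1 : ∫ x, Ψ (orbitMeasure N T x) ∂m =
      ∫ ν : ProbabilityMeasure X, ∫ x, u x ∂(ν : Measure X) ∂l := h.1.integral_eq u
  have hi : ∀ j, Integrable (fun ν : ProbabilityMeasure X =>
      sqNormBirkhoff (ν : Measure X) T (φ j) N - (∫ x, φ j x ∂(ν : Measure X)) ^ 2) l := fun j =>
    ((continuous_sqNormBirkhoff_probabilityMeasure T (φ j) N).integrable_of_compactSpace l).sub
      ((continuous_sq_integral (φ j)).integrable_of_compactSpace l)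
  have hS : Integrable (fun ν : ProbabilityMeasure X => ∑ j ∈ J,
      (sqNormBirkhoff (ν : Measure X) T (φ j) N - (∫ x, φ j x ∂(ν : Measure X)) ^ 2)) l :=
    integrable_finsetSum _ fun j _ => hi j
  have hi' : Integrable (fun ν : ProbabilityMeasure X => ε + C * ∑ j ∈ J,
      (sqNormBirkhoff (ν : Measure X) T (φ j) N - (∫ x, φ j x ∂(ν : Measure X)) ^ 2)) l :=
    (integrable_const ε).add (hS.const_mul C)
  have e2 : ε + C * ∑ j ∈ J, (sqNormBirkhoff m T (φ j) N - meanSqIntegral l (φ j)) =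
      ∫ ν : ProbabilityMeasure X, ε + C * ∑ j ∈ J,
        (sqNormBirkhoff (ν : Measure X) T (φ j) N - (∫ x, φ j x ∂(ν : Measure X)) ^ 2) ∂l := by
    rw [integral_add (integrable_const ε) (hS.const_mul C), integral_const_mul,
      integral_finsetSum _ fun j _ => hi j]
    simp only [integral_const, probReal_univ, one_smul]
    congr 2
    refine Finset.sum_congr rfl fun j _ => ?_
    rw [integral_sub ((continuous_sqNormBirkhoff_probabilityMeasure T (φ j) N
      ).integrable_of_compactSpace l) ((continuous_sq_integral (φ j)).integrable_of_compactSpace l),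
      h.1.sqNormBirkhoff_eq]
    rfl
  rw [e1, e2, ← integral_sub (Ψ.integrable_of_compactSpace l)
    (hucont.integrable_of_compactSpace l)]
  refine abs_integral_le_integral_abs.trans (integral_mono_ae
    ((Ψ.continuous.sub hucont).abs.integrable_of_compactSpace l) hi' ?_)
  filter_upwards [h.2] with ν hν
  have hsq : ∀ j, Integrable (fun x =>
      (∫ y, φ j y ∂(ν : Measure X) - birkhoffAverage ℝ T (φ j) (N + 1) x) ^ 2) (ν : Measure X) :=
    fun j => ((ContinuousMap.const X _ - continuousBirkhoffAverage T (φ j) (N + 1)) ^ 2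
      ).integrable_of_compactSpace _
  have hsqS : Integrable (fun x => ∑ j ∈ J, (∫ y, φ j y ∂(ν : Measure X) -
      birkhoffAverage ℝ T (φ j) (N + 1) x) ^ 2) (ν : Measure X) :=
    integrable_finsetSum _ fun j _ => hsq j
  have e3 : ∀ j, sqNormBirkhoff (ν : Measure X) T (φ j) N - (∫ x, φ j x ∂(ν : Measure X)) ^ 2 =
      ∫ x, (∫ y, φ j y ∂(ν : Measure X) - birkhoffAverage ℝ T (φ j) (N + 1) x) ^ 2
        ∂(ν : Measure X) := fun j =>
    (integral_sq_integral_sub_birkhoffAverage hν.toMeasurePreserving (φ j) N.succ_ne_zero).symm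
  have e4 : Ψ ν - ∫ x, u x ∂(ν : Measure X) = ∫ x, (Ψ ν - u x) ∂(ν : Measure X) := by
    rw [integral_sub (integrable_const _) (u.integrable_of_compactSpace _)]
    simp
  have e5 : ε + C * ∑ j ∈ J, (sqNormBirkhoff (ν : Measure X) T (φ j) N -
        (∫ x, φ j x ∂(ν : Measure X)) ^ 2) =
      ∫ x, ε + C * ∑ j ∈ J, (∫ y, φ j y ∂(ν : Measure X) -
        birkhoffAverage ℝ T (φ j) (N + 1) x) ^ 2 ∂(ν : Measure X) := by
    rw [integral_add (integrable_const ε) (hsqS.const_mul C), integral_const_mul,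
      integral_finsetSum _ fun j _ => hsq j]
    simp [e3]
  rw [e4, e5]
  refine abs_integral_le_integral_abs.trans (integral_mono
    (((integrable_const _).sub (u.integrable_of_compactSpace _)).abs)
    ((integrable_const ε).add (hsqS.const_mul C)) fun x => ?_)
  have := hΨ ν (orbitMeasure N T x)
  simp only [integral_orbitMeasure] at this
  exact this

end CompactSpace

/-! ### Uniqueness and generic continuity -/

section CompactSpace

variable {X : Type*} [TopologicalSpace X] [CompactSpace X] [T2Space X] [SecondCountableTopology X]
  [MeasurableSpace X] [BorelSpace X] {m : Measure X} [IsProbabilityMeasure m]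

theorem IsErgodicDecomposition.tendsto_sum_sqNormBirkhoff_sub {T : C(X, X)}
    {l : Measure (ProbabilityMeasure X)} [IsProbabilityMeasure l]
    (h : IsErgodicDecomposition T m l) (φ : ℕ → C(X, ℝ)) (ε C : ℝ) (J : Finset ℕ) :
    Tendsto (fun N => ε + C * ∑ j ∈ J, (sqNormBirkhoff m T (φ j) N - meanSqIntegral l (φ j)))
      atTop (𝓝 ε) := by
  have h1 : Tendsto (fun N => ∑ j ∈ J, (sqNormBirkhoff m T (φ j) N - meanSqIntegral l (φ j)))
      atTop (𝓝 (∑ j ∈ J, 0)) := tendsto_finsetSum _ fun j _ => by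
    rw [← sub_self (meanSqIntegral l (φ j))]
    exact (h.tendsto_sqNormBirkhoff (φ j)).sub_const _
  simpa using (h1.const_mul C).const_add ε

/-- An ergodic decomposition is the limit of the distributions of the orbit measures. -/
theorem IsErgodicDecomposition.tendsto_integral_orbitMeasure {T : C(X, X)}
    {l : Measure (ProbabilityMeasure X)} [IsProbabilityMeasure l]
    (h : IsErgodicDecomposition T m l) (Ψ : C(ProbabilityMeasure X, ℝ)) :
    Tendsto (fun N => ∫ x, Ψ (orbitMeasure N T x) ∂m) atTop (𝓝 (∫ ν, Ψ ν ∂l)) := by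
  refine Metric.tendsto_nhds.2 fun ε hε => ?_
  obtain ⟨J, C, -, hΨ⟩ := exists_abs_sub_le_add_mul_sum_sq
    (TopologicalSpace.denseRange_denseSeq C(X, ℝ)) Ψ (half_pos hε)
  filter_upwards [(h.tendsto_sum_sqNormBirkhoff_sub _ (ε / 2) C J).eventually_lt_const
    (half_lt_self hε)] with N hN
  rw [dist_comm, Real.dist_eq]
  exact (h.abs_integral_sub_integral_orbitMeasure_le hΨ N).trans_lt hN

/-- The ergodic decomposition of an invariant measure is unique. -/
theorem IsErgodicDecomposition.unique {T : C(X, X)} {l l' : ProbabilityMeasure (ProbabilityMeasure X)}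
    (h : IsErgodicDecomposition T m (l : Measure (ProbabilityMeasure X)))
    (h' : IsErgodicDecomposition T m (l' : Measure (ProbabilityMeasure X))) : l = l' := by
  let _ : MetricSpace X := TopologicalSpace.metrizableSpaceMetric X
  refine Subtype.ext ?_
  change (l : Measure (ProbabilityMeasure X)) = (l' : Measure (ProbabilityMeasure X))
  exact ext_of_forall_integral_eq_of_IsFiniteMeasure fun f =>
    tendsto_nhds_unique (h.tendsto_integral_orbitMeasure f.toContinuousMap)
      (h'.tendsto_integral_orbitMeasure f.toContinuousMap)

/-- For a continuous family of continuous maps of a compact metrizable space that preserve a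
probability measure `m`, the ergodic decomposition of `m` is continuous at the points of a
residual set of parameters. -/
theorem setOf_continuousAt_ergodicDecomposition_mem_residual {V : Type*} [TopologicalSpace V]
    {τ : V → C(X, X)} (hτ : Continuous τ) {κ : V → ProbabilityMeasure (ProbabilityMeasure X)}
    (hκ : ∀ v, IsErgodicDecomposition (τ v) m (κ v : Measure (ProbabilityMeasure X))) :
    {v | ContinuousAt κ v} ∈ residual V := by
  let φ : ℕ → C(X, ℝ) := TopologicalSpace.denseSeq C(X, ℝ)
  have hB : ∀ j N, Continuous fun v => sqNormBirkhoff m (τ v) (φ j) N := fun j N =>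
    (continuous_sqNormBirkhoff_map m (φ j) N).comp hτ
  -- An infimum of continuous functions: a bound attained by some second moment at `v` persists
  -- nearby and dominates the mean square there.
  have husc : ∀ j, UpperSemicontinuous fun v =>
      meanSqIntegral (κ v : Measure (ProbabilityMeasure X)) (φ j) := fun j v c hc => by
    obtain ⟨N, hN⟩ := (((hκ v).tendsto_sqNormBirkhoff (φ j)).eventually_lt_const hc).exists
    filter_upwards [(hB j N).continuousAt.eventually_lt_const hN] with w hw
    exact ((hκ w).meanSqIntegral_le (φ j) N).trans_lt hw
  filter_upwards [countable_iInter_mem.2 fun j => (husc j).setOf_continuousAt_mem_residual]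
    with v hv
  have hH : ∀ j, ContinuousAt (fun w =>
      meanSqIntegral (κ w : Measure (ProbabilityMeasure X)) (φ j)) v := Set.mem_iInter.1 hv
  refine ProbabilityMeasure.tendsto_iff_forall_integral_tendsto.2 fun f => ?_
  refine Metric.tendsto_nhds.2 fun ε hε => ?_
  obtain ⟨J, C, -, hΨ⟩ := exists_abs_sub_le_add_mul_sum_sq
    (TopologicalSpace.denseRange_denseSeq C(X, ℝ)) f.toContinuousMap (by positivity : 0 < ε / 6)
  -- The total error is split in three: the comparison at `w`, the comparison at `v`, and the change
  -- of the orbit distribution. Starting from `ε / 6` leaves room for the comparison bound to be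
  -- strictly below `ε / 3`.
  obtain ⟨N, hN⟩ := (((hκ v).tendsto_sum_sqNormBirkhoff_sub φ (ε / 6) C J).eventually_lt_const
    (by linarith : ε / 6 < ε / 3)).exists
  -- Here continuity of the mean squares at `v` is decisive: the bound found at `v` persists at
  -- nearby `w` with the same `N`.
  have hcont : ContinuousAt (fun w => ε / 6 + C * ∑ j ∈ J, (sqNormBirkhoff m (τ w) (φ j) N -
      meanSqIntegral (κ w : Measure (ProbabilityMeasure X)) (φ j))) v :=
    ((tendsto_finsetSum _ fun j _ => ((hB j N).continuousAt.sub (hH j)).tendsto).const_mul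
      C).const_add _
  have hτ' : Continuous fun p : V × X => ((τ p.1, p.2) : C(X, X) × X) := by fun_prop
  have hor' := f.continuous.comp ((continuous_orbitMeasure_uncurry N).comp hτ')
  have hor : Continuous fun w => ∫ x, f (orbitMeasure N (τ w) x) ∂m :=
    continuous_integral_of_continuous_uncurry m hor'
  filter_upwards [hcont.eventually_lt_const hN,
    Metric.tendsto_nhds.1 hor.continuousAt (ε / 3) (by positivity)] with w hw1 hw2
  have h1 := (hκ w).abs_integral_sub_integral_orbitMeasure_le hΨ N
  have h2 := (hκ v).abs_integral_sub_integral_orbitMeasure_le hΨ N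
  have h3 := h1.trans_lt hw1
  have h4 := h2.trans_lt hN
  simp only [Real.dist_eq, BoundedContinuousFunction.coe_toContinuousMap] at hw2 h3 h4 ⊢
  rw [abs_lt] at hw2 h3 h4 ⊢
  constructor <;> linarith [hw2.1, hw2.2, h3.1, h3.2, h4.1, h4.2]

end CompactSpace

/-! ### Application to volume-preserving diffeomorphisms -/

theorem VolDiffeo.continuous_toMap {d : ℕ} {M : Type*} [TopologicalSpace M]
    [ChartedSpace (EuclideanSpace ℝ (Fin d)) M] [MeasurableSpace M] {r : ℕ} {m : Measure M} :
    Continuous (VolDiffeo.toMap : VolDiffeo d r m → C(M, M)) :=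
  continuous_fst.comp (continuous_iff_le_induced.2 inf_le_left :
    Continuous fun f : VolDiffeo d r m => (VolDiffeo.toMap f, VolDiffeo.invMap f))

/-- Let `M` be a compact connected smooth manifold of dimension `d`, let `m` be a smooth volume
probability measure on `M`, and let `r ≥ 0`.  Every `f` in `Diff^r_m(M)` has exactly one ergodic
decomposition `κ f` of `m`, and the points of continuity of the map `κ` from `Diff^r_m(M)` to
the space of probability measures on the space of probability measures on `M` form a residual
set. -/
theorem theoremt {d : ℕ} {M : Type*} [TopologicalSpace M] [T2Space M] [SecondCountableTopology M]
    [CompactSpace M] [ConnectedSpace M] [ChartedSpace (EuclideanSpace ℝ (Fin d)) M]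
    [IsManifold (𝓡 d) ∞ M] [MeasurableSpace M] [BorelSpace M]
    (m : Measure M) [IsProbabilityMeasure m] (hm : IsSmoothVolume d m) (r : ℕ) :
    ∃ κ : VolDiffeo d r m → ProbabilityMeasure (ProbabilityMeasure M),
      (∀ (f : VolDiffeo d r m) (l : ProbabilityMeasure (ProbabilityMeasure M)),
        IsErgodicDecomposition f.toMap m (l : Measure (ProbabilityMeasure M)) ↔ l = κ f) ∧
      {f : VolDiffeo d r m | ContinuousAt κ f} ∈ residual (VolDiffeo d r m) := by
  have hinv : ∀ f : VolDiffeo d r m, MeasurePreserving f.toMap m m := fun f => f.2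
  choose κ hκ using fun f => exists_isErgodicDecomposition (hinv f)
  refine ⟨κ, fun f l => ⟨fun h => h.unique (hκ f), fun h => h ▸ hκ f⟩, ?_⟩
  exact setOf_continuousAt_ergodicDecomposition_mem_residual VolDiffeo.continuous_toMap hκ
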